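/- Let \(G\) be a connected \(d\)-dimensional Lie group with a left-invariant vector-field basis \(D^1,\dots,D^d\), a left Haar (volume) measure \(\mu\), and modular function \(\Delta\), where \(\mu(Sg)=\Delta(g)\mu(S)\). Let \(\mathcal H_k\) be a real reproducing kernel Hilbert space on \(G\) with kernel \(k\in C^2(G\times G)\). For a locally Lipschitz probability density \(p\) (all densities are with respect to \(\mu\)) put \[ \mathcal A^l_p h = D^l h + h\,D^l\log p + h\,D^l\Delta ,\qquad \mathcal A_p f=\sum_{l=1}^d \mathcal A^l_p f_l\quad (f=(f_1,\dots,f_d)\in\mathcal H_k^d), \] where \(D^l\log p\) is set to \(0\) at points where \(p=0\) or where \(p\) is not differentiable. Let \(k_p(x,y)=\sum_{l=1}^d \tilde{\mathcal A}^l_p\mathcal A^l_p k(x,y)\), where \(\mathcal A_p^l\) acts on the first argument of \(k\) and \(\tilde{\mathcal A}^l_p\) is the same operator acting on the second one, and let \[ \mathrm{KSD}(p,q)=\sup\Big\{\int_G \mathcal A_p f\; q\,d\mu : f\in\mathcal H_k^d,\ \|f\|_{\mathcal H_k^d}\le 1\Big\}. \] Let \((\Theta,d)\) be a metric space, \((p_\theta)_{\theta\in\Theta}\)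 a family of locally Lipschitz probability densities, \(q\) a locally Lipschitz probability density, and \(w\) a probability density with \(q=0\) \(\mu\)-a.e. on \(\{w=0\}\). Let \(x_1,x_2,\dots\) be i.i.d. with density \(w\), and put \[ V_\theta(x,y)=\frac{k_{p_\theta}(x,y)\,q(x)\,q(y)}{w(x)\,w(y)},\qquad \mathrm{wKSD}_n^2(\theta)=\frac1{n^2}\sum_{i,j=1}^n V_\theta(x_i,x_j),\qquad \mathrm{KSD}(\theta)=\mathrm{KSD}(p_\theta,q), \] with \(V_\theta(x,y):=0\) if \(w(x)w(y)=0\). Suppose that \((\theta,x,y)\mapsto V_\theta(x,y)\) is jointly continuous on \(\Theta\times\{w>0\}\times\{w>0\}\), and that \(x\mapsto\sup_{\theta\in K}V_\theta(x,x)\) is \(w\)-integrable for every compact \(K\subset\Theta\). Then: 1. For every \(\theta\), \(\mathcal A_{p_\theta}f\) is \(q\)-integrable for every \(f\in\mathcal H_k^d\), and \(\mathrm{KSD}(\theta)<\infty\). 2. For every compact \(K\subset\Theta\), almost surely, \(\mathrm{wKSD}_n^2(\theta)\to\mathrm{KSD}^2(\theta)\) uniformly on \(K\). 3. If \(\Theta\)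 is locally compact, then every \(\mathrm{wKSD}_n\) (for every realization of the sample) and \(\mathrm{KSD}\) are continuous on \(\Theta\). -/

import Mathlib

open MeasureTheory ProbabilityTheory Filter Topology
open scoped Manifold ContDiff ENNReal

noncomputable section

namespace LieKSD

/-- `p` is a probability density with respect to `μ`. -/
structure IsProbDensity {G : Type*} [MeasurableSpace G] (μ : Measure G) (p : G → ℝ) : Prop where
  measurable : Measurable p
  nonneg : ∀ x, 0 ≤ p x
  lintegral_eq_one : ∫⁻ x, ENNReal.ofReal (p x) ∂μ = 1

/-- The distribution `p dμ` with density `p`. -/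
def distr {G : Type*} [MeasurableSpace G] (μ : Measure G) (p : G → ℝ) : Measure G :=
  μ.withDensity (fun x => ENNReal.ofReal (p x))

section LieGroup

variable {E : Type*} [NormedAddCommGroup E] [NormedSpace ℝ E]
  {G : Type*} [TopologicalSpace G] [ChartedSpace E G]

variable (E) in
/-- Local Lipschitz continuity of a function on a manifold: around each point, the function read in
the chart at that point is Lipschitz. (Smooth changes of charts preserve this.) -/
def LocLipschitz (f : G → ℝ) : Prop :=
  ∀ x : G, ∃ C : NNReal, ∃ t ∈ 𝓝 (extChartAt 𝓘(ℝ, E) x x),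
    LipschitzOnWith C (f ∘ (extChartAt 𝓘(ℝ, E) x).symm) t

variable [Group G]

/-- The derivative `D f` of a function `f` along the left-invariant vector field `D` whose value at
the identity is `v`. -/
def lieD (v : GroupLieAlgebra 𝓘(ℝ, E) G) (f : G → ℝ) (x : G) : ℝ :=
  mfderiv 𝓘(ℝ, E) 𝓘(ℝ, ℝ) f x (mulInvariantVectorField v x)

/-- `D log p`, set to `0` where `p = 0` (and, by the convention for `mfderiv`, at the points of
non-differentiability, which form a null set if `p` is locally Lipschitz). -/
def score (v : GroupLieAlgebra 𝓘(ℝ, E) G) (p : G → ℝ) (x : G) : ℝ :=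
  open Classical in
  if p x = 0 then 0 else lieD v (fun y => Real.log (p y)) x

variable [FiniteDimensional ℝ E] [LieGroup 𝓘(ℝ, E) ∞ G]

variable (E) in
/-- The modular function `Δ`, normalised by `R_g^* Ω = Δ_g Ω` for a left-invariant volume form `Ω`,
i.e. `μ (S g) = Δ_g μ (S)` for a left Haar measure `μ`. Mathlib's modular character is normalised by
`μ (S g⁻¹) = modularCharacterFun g * μ (S)`, whence the inverse. -/
def modularFn (g : G) : ℝ :=
  haveI : IsTopologicalGroup G := topologicalGroup_of_lieGroup 𝓘(ℝ, E) ∞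
  haveI : LocallyCompactSpace G := Manifold.locallyCompact_of_finiteDimensional 𝓘(ℝ, E)
  (Measure.modularCharacterFun g⁻¹ : NNReal)

/-- The component `h ↦ D h + h D log p + h D Δ` of the Stein operator, for the left-invariant field
`D` with value `v` at the identity. -/
def steinOp (v : GroupLieAlgebra 𝓘(ℝ, E) G) (p h : G → ℝ) (x : G) : ℝ :=
  lieD v h x + h x * score v p x + h x * lieD v (modularFn E) x

end LieGroup

section Kernel

variable {G : Type*} (H : Type*) [NormedAddCommGroup H] [InnerProductSpace ℝ H] [CompleteSpace H]
  [RKHS ℝ H G ℝ]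

/-- The scalar reproducing kernel `k` of the real reproducing kernel Hilbert space `H` on `G`. -/
def kernelFn (x y : G) : ℝ := RKHS.kernel H x y 1

variable {E : Type*} [NormedAddCommGroup E] [NormedSpace ℝ E] [FiniteDimensional ℝ E]
  [TopologicalSpace G] [ChartedSpace E G] [Group G] [LieGroup 𝓘(ℝ, E) ∞ G]
  {d : ℕ} (b : Module.Basis (Fin d) ℝ (GroupLieAlgebra 𝓘(ℝ, E) G))

/-- The Stein kernel `k_p`: for each `l` the component `A_p^l` acts on the first argument of `k`,
then on the second one, and the results are summed over `l`. -/
def steinKernel (p : G → ℝ) (x y : G) : ℝ :=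
  ∑ l, steinOp (b l) p (fun y' => steinOp (b l) p (fun x' => kernelFn H x' y') x) y

variable {H} in
/-- The Stein operator `A_p f = ∑ l, A_p^l f_l` for `f` in the Hilbert space product `H^d`. -/
def steinOpVec (p : G → ℝ) (f : PiLp 2 (fun _ : Fin d => H)) (x : G) : ℝ :=
  ∑ l, steinOp (b l) p (f l) x

/-- The kernel Stein discrepancy: the supremum of `E_q [A_p f]` over the unit ball of `H^d`. -/
def ksd [MeasurableSpace G] (μ : Measure G) (p q : G → ℝ) : ℝ :=
  sSup {r : ℝ | ∃ f : PiLp 2 (fun _ : Fin d => H), ‖f‖ ≤ 1 ∧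
    r = ∫ x, steinOpVec b p f x * q x ∂μ}

/-- `V (x, y) = k_p (x, y) q (x) q (y) / (w (x) w (y))`. -/
def weightedKernel (p q w : G → ℝ) (x y : G) : ℝ :=
  steinKernel H b p x y * q x * q y * (w x)⁻¹ * (w y)⁻¹

/-- The squared weighted empirical discrepancy of the sample points `x 0, …, x (n - 1)`. -/
def wksdSq (p q w : G → ℝ) (n : ℕ) (x : ℕ → G) : ℝ :=
  1 / (n : ℝ) ^ 2 * ∑ i ∈ Finset.range n, ∑ j ∈ Finset.range n,
    weightedKernel H b p q w (x i) (x j)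

/-- The weighted empirical discrepancy. -/
def wksd (p q w : G → ℝ) (n : ℕ) (x : ℕ → G) : ℝ := √(wksdSq H b p q w n x)

end Kernel

end LieKSD

end

/-!
Since `k` is `C²`, evaluation of `𝒜ˡ_p h` at a point is a bounded functional of `h ∈ H`: in a chart,
`‖k(·, y) - k(·, x)‖²` is a `C²` function of `y` with a minimum at `x`, so `y ↦ k(·, y)` is
pointwise Lipschitz, and this makes the set of `h` differentiable at `x` closed; it contains the
dense span of the sections of `k`. The Riesz representers form a feature map `Φ_θ` with values in
`H^d`, the importance weighting gives `Ψ_θ = q w⁻¹ Φ_θ`, and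
`V_θ (x, y) = ⟪Ψ_θ x, Ψ_θ y⟫`, `KSD(θ) = ‖∫ Ψ_θ w dμ‖`.

For a compact set `K` of parameters, `V` is a single kernel on `G` with values in the Banach space
`C(K, ℝ)`, dominated by `s (x) s (y)` with `s (x)² = sup_{θ ∈ K} V_θ (x, x)`, and uniform
convergence on `K` is the strong law of large numbers for its V-statistics. Over a compact
`C ⊆ {w > 0}` the double mean is an iterated mean, the inner one taken in `C(C, C(K, ℝ))`, so the
law for sample means applies twice; the error of the truncation to `C × C` is controlled by the
sample means of `s`. The limit lies in `C(K, ℝ)`, which gives the continuity of `KSD` on `K`.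
-/

namespace LieKSD

open scoped RealInnerProductSpace
open Asymptotics

section Differentiability

variable {E : Type*} [NormedAddCommGroup E] [NormedSpace ℝ E]
  {F : Type*} [NormedAddCommGroup F] [NormedSpace ℝ F] {f : E → F} {x : E}

theorem isBigO_sub_norm_sq_of_fderiv_eq_zero (hf : ContDiffAt ℝ 2 f x) (h0 : fderiv ℝ f x = 0) :
    (fun y => f y - f x) =O[𝓝 x] fun y => ‖y - x‖ ^ 2 := by
  have hderiv : (fun y => fderiv ℝ f y) =O[𝓝 x] fun y => y - x := by
    simpa [h0] using ((hf.fderiv_right (m := 1) (by norm_num)).differentiableAt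
      (by norm_num)).isBigO_sub
  obtain ⟨C, hC⟩ := hderiv.bound
  have hdiff : ∀ᶠ y in 𝓝 x, DifferentiableAt ℝ f y :=
    (hf.eventually (by simp)).mono fun y hy => hy.differentiableAt (by norm_num)
  obtain ⟨r, hr, hball⟩ := Metric.eventually_nhds_iff_ball.1 (hdiff.and hC)
  refine IsBigO.of_bound |C| ?_
  filter_upwards [Metric.ball_mem_nhds x hr] with y hy
  have hmvt := (convex_closedBall x ‖y - x‖).norm_image_sub_le_of_norm_fderiv_le (f := f) (𝕜 := ℝ)
    (x := x) (y := y) (C := |C| * ‖y - x‖)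
    (fun z hz => (hball z (Metric.closedBall_subset_ball (mem_ball_iff_norm.1 hy) hz)).1)
    (fun z hz => (hball z (Metric.closedBall_subset_ball (mem_ball_iff_norm.1 hy) hz)).2.trans
      (mul_le_mul (le_abs_self C) (mem_closedBall_iff_norm.1 hz) (norm_nonneg _) (abs_nonneg C)))
    (Metric.mem_closedBall_self (norm_nonneg _)) (mem_closedBall_iff_norm.2 le_rfl)
  rwa [norm_pow, norm_norm, sq, ← mul_assoc]

theorem differentiableAt_of_forall_exists_isBigOWith [CompleteSpace F]
    (h : ∀ ε > 0, ∃ L : E →L[ℝ] F,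
      IsBigOWith ε (𝓝 x) (fun y => f y - f x - L (y - x)) fun y => y - x) :
    DifferentiableAt ℝ f x := by
  choose L hL using fun n : ℕ => h _ (Nat.one_div_pos_of_nat (α := ℝ) (n := n))
  have hdist : ∀ N n m : ℕ, N ≤ n → N ≤ m →
      dist (L n) (L m) ≤ 1 / ((N : ℝ) + 1) + 1 / ((N : ℝ) + 1) := by
    intro N n m hn hm
    rw [dist_eq_norm]
    refine ((L n - L m).hasFDerivAt (x := x)).le_of_lip' (by positivity) ?_
    filter_upwards [((hL m).sub (hL n)).bound] with y hy
    have hsplit : (L n - L m) y - (L n - L m) x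
        = f y - f x - L m (y - x) - (f y - f x - L n (y - x)) := by
      simp only [sub_apply, map_sub]
      abel
    rw [hsplit]
    exact hy.trans (by gcongr)
  have htendsto := tendsto_one_div_add_atTop_nhds_zero_nat (𝕜 := ℝ)
  obtain ⟨L', hL'⟩ := cauchySeq_tendsto_of_complete <| cauchySeq_of_le_tendsto_0 _
    (fun n m N => hdist N n m) (by simpa using htendsto.add htendsto)
  refine HasFDerivAt.differentiableAt (f' := L') (.of_isLittleO (isLittleO_iff_forall_isBigOWith.2
    fun ε hε => ?_))
  have hsum : Tendsto (fun n : ℕ => 1 / ((n : ℝ) + 1) + ‖L n - L'‖) atTop (𝓝 0) := by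
    simpa using htendsto.add (tendsto_iff_norm_sub_tendsto_zero.1 hL')
  obtain ⟨n, hn⟩ := (hsum.eventually_le_const hε).exists
  refine (((hL n).add ((L n - L').isBigOWith_comp (fun y => y - x) (𝓝 x))).weaken hn).congr_left
    fun y => ?_
  simp only [sub_apply]
  abel

end Differentiability

section WeakDerivative

variable {E : Type*} [NormedAddCommGroup E] {F : Type*} [NormedAddCommGroup F]
  [InnerProductSpace ℝ F] {κ : E → F} {x : E}

theorem norm_sub_sq_eq_inner (a b : F) : ‖a - b‖ ^ 2 = ⟪a, a⟫ - 2 * ⟪a, b⟫ + ⟪b, b⟫ := by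
  rw [norm_sub_sq_real, real_inner_self_eq_norm_sq, real_inner_self_eq_norm_sq]

theorem isBigOWith_inner_sub {C : ℝ} (h : IsBigOWith C (𝓝 x) (fun y => κ y - κ x) fun y => y - x)
    (g : F) : IsBigOWith (‖g‖ * C) (𝓝 x) (fun y => ⟪g, κ y⟫ - ⟪g, κ x⟫) fun y => y - x := by
  simpa only [← inner_sub_right, innerSL_apply_apply, innerSL_apply_norm] using
    ((innerSL ℝ g).isBigOWith_comp (fun y => κ y - κ x) (𝓝 x)).trans h (norm_nonneg _)

variable [NormedSpace ℝ E]

theorem isBigO_sub_of_contDiffAt_inner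
    (h : ContDiffAt ℝ 2 (fun z : E × E => ⟪κ z.1, κ z.2⟫) (x, x)) :
    (fun y => κ y - κ x) =O[𝓝 x] fun y => y - x := by
  have hdiag : ContDiffAt ℝ 2 (fun y => ⟪κ y, κ y⟫) x :=
    h.comp (f := fun y : E => (y, y)) x (contDiffAt_id.prodMk contDiffAt_id)
  have hleft : ContDiffAt ℝ 2 (fun y => ⟪κ y, κ x⟫) x :=
    h.comp (f := fun y : E => (y, x)) x (contDiffAt_id.prodMk contDiffAt_const)
  have hsq : ContDiffAt ℝ 2 (fun y => ‖κ y - κ x‖ ^ 2) x := by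
    simp only [norm_sub_sq_eq_inner]
    exact (hdiag.sub (contDiffAt_const.mul hleft)).add contDiffAt_const
  -- the squared distance to `κ x` is minimal at `x`, so it has no first-order term there
  have hmin : IsLocalMin (fun y => ‖κ y - κ x‖ ^ 2) x :=
    Eventually.of_forall fun y => by simp
  have hquad : (fun y => ‖κ y - κ x‖ ^ 2) =O[𝓝 x] fun y => ‖y - x‖ ^ 2 := by
    simpa using isBigO_sub_norm_sq_of_fderiv_eq_zero hsq hmin.fderiv_eq_zero
  exact (hquad.of_pow two_ne_zero).of_norm_norm

theorem isClosed_setOf_differentiableAt_inner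
    (h : (fun y => κ y - κ x) =O[𝓝 x] fun y => y - x) :
    IsClosed {g : F | DifferentiableAt ℝ (fun y => ⟪g, κ y⟫) x} := by
  obtain ⟨C, hC⟩ := h.isBigOWith
  refine isClosed_of_closure_subset fun g hg =>
    differentiableAt_of_forall_exists_isBigOWith fun ε hε => ?_
  obtain ⟨g', hg', hlt⟩ := Metric.mem_closure_iff.1 hg (ε / 2 / (|C| + 1)) (by positivity)
  have hnear : ‖g - g'‖ * C ≤ ε / 2 := by
    rw [dist_eq_norm, lt_div_iff₀ (by positivity)] at hlt
    nlinarith [norm_nonneg (g - g'), le_abs_self C]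
  refine ⟨fderiv ℝ (fun y => ⟪g', κ y⟫) x, ?_⟩
  have hlittle := isLittleO_iff_forall_isBigOWith.1
    (DifferentiableAt.hasFDerivAt hg').isLittleO (half_pos hε)
  refine (((isBigOWith_inner_sub hC (g - g')).add hlittle).congr_left
    fun y => ?_).weaken (by linarith)
  simp only [inner_sub_left]
  ring

theorem exists_fderiv_inner_eq_inner [CompleteSpace F]
    (h : (fun y => κ y - κ x) =O[𝓝 x] fun y => y - x)
    (hd : ∀ g, DifferentiableAt ℝ (fun y => ⟪g, κ y⟫) x) (e : E) :
    ∃ ξ : F, ∀ g, fderiv ℝ (fun y => ⟪g, κ y⟫) x e = ⟪ξ, g⟫ := by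
  obtain ⟨C, hC0, hC⟩ := h.exists_nonneg
  let D : F →ₗ[ℝ] ℝ :=
    { toFun := fun g => fderiv ℝ (fun y => ⟪g, κ y⟫) x e
      map_add' := fun g g' => by
        simp only [inner_add_left, fderiv_fun_add (hd g) (hd g'), add_apply]
      map_smul' := fun c g => by
        simp only [real_inner_smul_left, fderiv_const_mul (hd g), smul_apply, RingHom.id_apply] }
  have hD : ∀ g, ‖D g‖ ≤ C * ‖e‖ * ‖g‖ := fun g =>
    calc ‖D g‖ ≤ ‖fderiv ℝ (fun y => ⟪g, κ y⟫) x‖ * ‖e‖ := ContinuousLinearMap.le_opNorm _ e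
      _ ≤ ‖g‖ * C * ‖e‖ := by
        gcongr
        exact (hd g).hasFDerivAt.le_of_lip' (by positivity) (isBigOWith_inner_sub hC g).bound
      _ = C * ‖e‖ * ‖g‖ := by ring
  refine ⟨(InnerProductSpace.toDual ℝ F).symm (D.mkContinuous _ hD), fun g => ?_⟩
  rw [InnerProductSpace.toDual_symm_apply]
  rfl

end WeakDerivative

section Representer

variable {G H : Type*} [NormedAddCommGroup H] [InnerProductSpace ℝ H] [CompleteSpace H]
  [RKHS ℝ H G ℝ]

theorem inner_kerFun_one (h : H) (x : G) : ⟪h, RKHS.kerFun H x 1⟫ = h x := by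
  simp

theorem coe_kerFun_one (y : G) : ⇑(RKHS.kerFun H y 1) = fun x => kernelFn H x y := by
  ext x
  rw [RKHS.kerFun_apply, kernelFn]

theorem kernelFn_eq_inner (x y : G) :
    kernelFn H x y = ⟪RKHS.kerFun H x 1, RKHS.kerFun H y 1⟫ := by
  rw [real_inner_comm, inner_kerFun_one, coe_kerFun_one]

variable {E : Type*} [NormedAddCommGroup E] [NormedSpace ℝ E] [TopologicalSpace G]
  [ChartedSpace E G]

variable (H E) in
/-- The canonical feature map `y ↦ k(·, y)` of the reproducing kernel Hilbert space `H`, read in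
the preferred chart at `x`. -/
noncomputable def chartFeature (x : G) (u : E) : H :=
  RKHS.kerFun H ((extChartAt 𝓘(ℝ, E) x).symm u) 1

theorem inner_chartFeature (h : H) (x : G) (u : E) :
    ⟪h, chartFeature H E x u⟫ = h ((extChartAt 𝓘(ℝ, E) x).symm u) :=
  inner_kerFun_one h _

theorem contDiffAt_kernelFn_comp
    (hk : ContMDiff (𝓘(ℝ, E).prod 𝓘(ℝ, E)) 𝓘(ℝ, ℝ) 2 (fun z : G × G => kernelFn H z.1 z.2))
    {U : Type*} [NormedAddCommGroup U] [NormedSpace ℝ U] {f g : U → G} {u : U}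
    (hf : ContMDiffAt 𝓘(ℝ, U) 𝓘(ℝ, E) 2 f u) (hg : ContMDiffAt 𝓘(ℝ, U) 𝓘(ℝ, E) 2 g u) :
    ContDiffAt ℝ 2 (fun u => kernelFn H (f u) (g u)) u :=
  contMDiffAt_iff_contDiffAt.1 <|
    ContMDiffAt.comp (f := fun u => (f u, g u)) u hk.contMDiffAt (hf.prodMk hg)

variable [IsManifold 𝓘(ℝ, E) 2 G]

theorem contMDiffAt_extChartAt_symm (x : G) :
    ContMDiffAt 𝓘(ℝ, E) 𝓘(ℝ, E) 2 (extChartAt 𝓘(ℝ, E) x).symm (extChartAt 𝓘(ℝ, E) x x) :=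
  (contMDiffOn_extChartAt_symm x).contMDiffAt (extChartAt_target_mem_nhds x)

theorem isBigO_chartFeature_sub
    (hk : ContMDiff (𝓘(ℝ, E).prod 𝓘(ℝ, E)) 𝓘(ℝ, ℝ) 2 (fun z : G × G => kernelFn H z.1 z.2))
    (x : G) :
    (fun u => chartFeature H E x u - chartFeature H E x (extChartAt 𝓘(ℝ, E) x x))
      =O[𝓝 (extChartAt 𝓘(ℝ, E) x x)] fun u => u - extChartAt 𝓘(ℝ, E) x x := by
  set u₀ := extChartAt 𝓘(ℝ, E) x x
  refine isBigO_sub_of_contDiffAt_inner ?_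
  have hsymm := contMDiffAt_extChartAt_symm (E := E) x
  have hfst : ContMDiffAt 𝓘(ℝ, E × E) 𝓘(ℝ, E) 2 (Prod.fst : E × E → E) (u₀, u₀) :=
    contDiffAt_fst.contMDiffAt
  have hsnd : ContMDiffAt 𝓘(ℝ, E × E) 𝓘(ℝ, E) 2 (Prod.snd : E × E → E) (u₀, u₀) :=
    contDiffAt_snd.contMDiffAt
  simpa only [chartFeature, ← kernelFn_eq_inner, Function.comp_apply] using
    contDiffAt_kernelFn_comp hk (hsymm.comp (f := Prod.fst) (u₀, u₀) hfst)
      (hsymm.comp (f := Prod.snd) (u₀, u₀) hsnd)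

theorem differentiableAt_inner_chartFeature
    (hk : ContMDiff (𝓘(ℝ, E).prod 𝓘(ℝ, E)) 𝓘(ℝ, ℝ) 2 (fun z : G × G => kernelFn H z.1 z.2))
    (x : G) (h : H) :
    DifferentiableAt ℝ (fun u => ⟪h, chartFeature H E x u⟫) (extChartAt 𝓘(ℝ, E) x x) := by
  set u₀ := extChartAt 𝓘(ℝ, E) x x
  let M : Submodule ℝ H :=
    { carrier := {f | DifferentiableAt ℝ (fun u => ⟪f, chartFeature H E x u⟫) u₀}
      add_mem' := fun {f g} hf hg => by
        simp only [Set.mem_ofPred_eq, inner_add_left] at *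
        exact hf.add hg
      zero_mem' := by simp
      smul_mem' := fun c f hf => by
        simp only [Set.mem_ofPred_eq, real_inner_smul_left] at *
        exact hf.const_mul c }
  have hker : ∀ y : G, RKHS.kerFun H y 1 ∈ M := fun y => by
    change DifferentiableAt ℝ _ u₀
    simpa only [chartFeature, ← kernelFn_eq_inner] using (contDiffAt_kernelFn_comp hk
      contMDiffAt_const (contMDiffAt_extChartAt_symm x)).differentiableAt two_ne_zero
  have hspan : Submodule.span ℝ {RKHS.kerFun H y v | (y : G) (v : ℝ)} ≤ M := by
    refine Submodule.span_le.2 ?_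
    rintro _ ⟨y, v, rfl⟩
    rw [← mul_one v, ← smul_eq_mul, map_smul]
    exact M.smul_mem v (hker y)
  have hclosure := Submodule.topologicalClosure_minimal _ hspan
    (isClosed_setOf_differentiableAt_inner (isBigO_chartFeature_sub hk x))
  rw [RKHS.kerFun_dense] at hclosure
  exact hclosure Submodule.mem_top

theorem mdifferentiableAt_of_contMDiff_kernelFn
    (hk : ContMDiff (𝓘(ℝ, E).prod 𝓘(ℝ, E)) 𝓘(ℝ, ℝ) 2 (fun z : G × G => kernelFn H z.1 z.2))
    (h : H) (x : G) : MDifferentiableAt 𝓘(ℝ, E) 𝓘(ℝ, ℝ) h x := by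
  have hd := differentiableAt_inner_chartFeature hk x h
  simp only [inner_chartFeature] at hd
  refine (mdifferentiableAt_iff _ _).2 ⟨?_, hd.differentiableWithinAt⟩
  refine (hd.continuousAt.comp (continuousAt_extChartAt x)).congr ?_
  filter_upwards [extChartAt_source_mem_nhds (I := 𝓘(ℝ, E)) x] with y hy
  exact congrArg h ((extChartAt 𝓘(ℝ, E) x).left_inv hy)

theorem exists_mfderiv_eq_inner
    (hk : ContMDiff (𝓘(ℝ, E).prod 𝓘(ℝ, E)) 𝓘(ℝ, ℝ) 2 (fun z : G × G => kernelFn H z.1 z.2))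
    (x : G) (v : TangentSpace 𝓘(ℝ, E) x) :
    ∃ ξ : H, ∀ h : H, mfderiv 𝓘(ℝ, E) 𝓘(ℝ, ℝ) (h : G → ℝ) x v = ⟪ξ, h⟫ := by
  obtain ⟨ξ, hξ⟩ := exists_fderiv_inner_eq_inner (isBigO_chartFeature_sub hk x)
    (differentiableAt_inner_chartFeature hk x) v
  refine ⟨ξ, fun h => ?_⟩
  rw [← hξ h, (mdifferentiableAt_of_contMDiff_kernelFn hk h x).mfderiv]
  simp only [inner_chartFeature, modelWithCornersSelf_coe, Set.range_id, fderivWithin_univ]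
  rfl

end Representer

section WeightedFeature

variable {G F : Type*} [AddCommGroup F] [Module ℝ F]

/-- The importance-weighted version `q w⁻¹ Φ` of a feature map `Φ`. It vanishes where `w = 0`. -/
noncomputable def weightedFeature (q w : G → ℝ) (Φ : G → F) (x : G) : F :=
  (q x * (w x)⁻¹) • Φ x

theorem weightedFeature_of_eq_zero {q w : G → ℝ} {Φ : G → F} {x : G} (hx : w x = 0) :
    weightedFeature q w Φ x = 0 := by
  rw [weightedFeature, hx, inv_zero, mul_zero, zero_smul]

end WeightedFeature

section SteinFeature

variable {E : Type*} [NormedAddCommGroup E] [NormedSpace ℝ E] [FiniteDimensional ℝ E]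
  {G : Type*} [TopologicalSpace G] [ChartedSpace E G] [Group G] [LieGroup 𝓘(ℝ, E) ∞ G]
  {H : Type*} [NormedAddCommGroup H] [InnerProductSpace ℝ H] [RKHS ℝ H G ℝ]
  {d : ℕ} {b : Module.Basis (Fin d) ℝ (GroupLieAlgebra 𝓘(ℝ, E) G)} {p q w : G → ℝ}
  {Φ : G → PiLp 2 (fun _ : Fin d => H)}

variable (b p) in
/-- `Φ` is the feature map of the Stein kernel of `p`: its `l`-th component at `x` is the Riesz
representer of `h ↦ 𝒜ˡ_p h (x)`. -/
def IsSteinFeature (Φ : G → PiLp 2 (fun _ : Fin d => H)) : Prop :=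
  ∀ x l (h : H), steinOp (b l) p h x = ⟪Φ x l, h⟫

theorem IsSteinFeature.steinOpVec_eq_inner (hΦ : IsSteinFeature b p Φ)
    (f : PiLp 2 (fun _ : Fin d => H)) (x : G) : steinOpVec b p f x = ⟪Φ x, f⟫ := by
  simp only [steinOpVec, PiLp.inner_apply, hΦ x]

theorem IsSteinFeature.steinOpVec_mul_eq (hΦ : IsSteinFeature b p Φ)
    (f : PiLp 2 (fun _ : Fin d => H)) {x : G} (hx : w x = 0 → q x = 0) :
    steinOpVec b p f x * q x = w x * ⟪f, weightedFeature q w Φ x⟫ := by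
  rw [hΦ.steinOpVec_eq_inner, weightedFeature, real_inner_smul_right, real_inner_comm]
  by_cases hw : w x = 0
  · rw [hx hw, hw, mul_zero, zero_mul]
  · field_simp

variable [CompleteSpace H]

theorem exists_steinOp_eq_inner
    (hk : ContMDiff (𝓘(ℝ, E).prod 𝓘(ℝ, E)) 𝓘(ℝ, ℝ) 2 (fun z : G × G => kernelFn H z.1 z.2))
    (v : GroupLieAlgebra 𝓘(ℝ, E) G) (p : G → ℝ) (x : G) :
    ∃ ξ : H, ∀ h : H, steinOp v p h x = ⟪ξ, h⟫ := by
  have : IsManifold 𝓘(ℝ, E) 2 G := IsManifold.of_le (n := ∞) (by norm_cast)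
  obtain ⟨ξ, hξ⟩ := exists_mfderiv_eq_inner hk x (mulInvariantVectorField v x)
  refine ⟨ξ + (score v p x + lieD v (modularFn E) x) • RKHS.kerFun H x 1, fun h => ?_⟩
  rw [inner_add_left, real_inner_smul_left, ← hξ h, real_inner_comm, inner_kerFun_one, steinOp,
    add_assoc, ← mul_add, mul_comm (h x)]
  rfl

variable (b p) in
theorem exists_isSteinFeature
    (hk : ContMDiff (𝓘(ℝ, E).prod 𝓘(ℝ, E)) 𝓘(ℝ, ℝ) 2 (fun z : G × G => kernelFn H z.1 z.2)) :
    ∃ Φ : G → PiLp 2 (fun _ : Fin d => H), IsSteinFeature b p Φ := by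
  choose ξ hξ using fun (x : G) (l : Fin d) => exists_steinOp_eq_inner hk (b l) p x
  exact ⟨fun x => WithLp.toLp 2 (ξ x), hξ⟩

theorem IsSteinFeature.steinKernel_eq_inner (hΦ : IsSteinFeature b p Φ) (x y : G) :
    steinKernel H b p x y = ⟪Φ x, Φ y⟫ := by
  have hfirst : ∀ l, (fun y' => steinOp (b l) p (fun x' => kernelFn H x' y') x) = Φ x l := by
    intro l
    ext y'
    rw [← coe_kerFun_one, hΦ x l, inner_kerFun_one]
  simp only [steinKernel, PiLp.inner_apply, hfirst, hΦ y, real_inner_comm]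

theorem IsSteinFeature.weightedKernel_eq_inner (hΦ : IsSteinFeature b p Φ) (x y : G) :
    weightedKernel H b p q w x y = ⟪weightedFeature q w Φ x, weightedFeature q w Φ y⟫ := by
  rw [weightedKernel, hΦ.steinKernel_eq_inner, weightedFeature, weightedFeature,
    real_inner_smul_left, real_inner_smul_right]
  ring

end SteinFeature

section SampleMean

open Finset (range)

variable {G B ι ι' : Type*} [NormedAddCommGroup B] [NormedSpace ℝ B]

/-- The mean of a vector-valued function over the sample points `x i`, `i ∈ s`, as a linear map of
the function. It is `0` for the empty sample. For a product index set and points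
`(x i, x j)` it is a V-statistic of order two. -/
noncomputable def sampleMean (s : Finset ι) (x : ι → G) : (G → B) →ₗ[ℝ] B :=
  (s.card : ℝ)⁻¹ • ∑ i ∈ s, LinearMap.proj (x i)

theorem sampleMean_apply (s : Finset ι) (x : ι → G) (f : G → B) :
    sampleMean s x f = (s.card : ℝ)⁻¹ • ∑ i ∈ s, f (x i) := by
  simp [sampleMean]

theorem map_sampleMean {B' : Type*} [NormedAddCommGroup B'] [NormedSpace ℝ B'] (L : B →L[ℝ] B')
    (s : Finset ι) (x : ι → G) (f : G → B) :
    L (sampleMean s x f) = sampleMean s x fun a => L (f a) := by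
  simp only [sampleMean_apply, map_smul, map_sum]

theorem norm_sampleMean_le {f : G → B} {g : G → ℝ} (h : ∀ a, ‖f a‖ ≤ g a) (s : Finset ι)
    (x : ι → G) : ‖sampleMean s x f‖ ≤ sampleMean s x g := by
  rw [sampleMean_apply, sampleMean_apply, norm_smul, norm_inv, RCLike.norm_natCast, smul_eq_mul]
  gcongr
  exact norm_sum_le_of_le _ fun i _ => h (x i)

theorem norm_sampleMean_le_of_norm_le {f : G → B} {C : ℝ} (hC : 0 ≤ C) (h : ∀ a, ‖f a‖ ≤ C)
    (s : Finset ι) (x : ι → G) : ‖sampleMean s x f‖ ≤ C := by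
  refine (norm_sampleMean_le h s x).trans ?_
  rw [sampleMean_apply, Finset.sum_const, nsmul_eq_mul, smul_eq_mul, ← mul_assoc]
  exact mul_le_of_le_one_left hC inv_mul_le_one

theorem sampleMean_product {G' : Type*} (s : Finset ι) (t : Finset ι') (x : ι → G) (y : ι' → G')
    (V : G × G' → B) :
    sampleMean (s ×ˢ t) (Prod.map x y) V
      = sampleMean s x fun a => sampleMean t y fun b => V (a, b) := by
  simp only [sampleMean_apply, Finset.card_product, Finset.sum_product, Prod.map_apply,
    Finset.smul_sum, smul_smul, Nat.cast_mul, mul_inv]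

theorem sampleMean_product_mul {G' : Type*} (s : Finset ι) (t : Finset ι') (x : ι → G)
    (y : ι' → G') (f : G → ℝ) (g : G' → ℝ) :
    sampleMean (s ×ˢ t) (Prod.map x y) (fun z => f z.1 * g z.2)
      = sampleMean s x f * sampleMean t y g := by
  simp only [sampleMean_apply, Finset.card_product, Finset.sum_product, Prod.map_apply,
    ← Finset.mul_sum, ← Finset.sum_mul, Nat.cast_mul, mul_inv, smul_eq_mul]
  ring

variable {Ω : Type*} [MeasurableSpace Ω] {P : Measure Ω} [MeasurableSpace G] {ν : Measure G}
  {X : ℕ → Ω → G} [CompleteSpace B]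

theorem ae_tendsto_sampleMean (hX : ∀ i, HasLaw (X i) ν P)
    (hind : Pairwise fun i j => X i ⟂ᵢ[P] X j) {f : G → B} (hf : Integrable f ν) :
    ∀ᵐ ξ ∂P, Tendsto (fun n => sampleMean (range n) (X · ξ) f) atTop (𝓝 (∫ x, f x ∂ν)) := by
  borelize B
  have hfm : ∀ i, AEMeasurable f (P.map (X i)) := fun i => by
    rw [(hX i).map_eq]
    exact hf.aestronglyMeasurable.aemeasurable
  have hint : Integrable (f ∘ X 0) P :=
    ((hX 0).map_eq ▸ hf).comp_aemeasurable (hX 0).aemeasurable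
  have hslln := strong_law_ae (fun i => f ∘ X i) hint
    (fun i j hij => (hind hij).comp₀ (hX i).aemeasurable (hX j).aemeasurable (hfm i) (hfm j))
    (fun i => ((hX i).identDistrib (hX 0)).comp_of_aemeasurable (hfm i))
  rw [(hX 0).integral_comp hf.aestronglyMeasurable] at hslln
  simpa only [sampleMean_apply, Finset.card_range, Function.comp_apply] using hslln

end SampleMean

section ExtendByZero

variable {G B ι : Type*} [TopologicalSpace G] {C : Set G} [NormedAddCommGroup B]

/-- The extension by zero of a continuous function on a subset. -/
noncomputable def extendByZero (φ : C(C, B)) : G → B :=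
  Function.extend Subtype.val φ 0

theorem extendByZero_apply_coe (φ : C(C, B)) (a : C) : extendByZero φ a = φ a :=
  Subtype.val_injective.extend_apply _ _ _

theorem extendByZero_of_notMem (φ : C(C, B)) {a : G} (ha : a ∉ C) : extendByZero φ a = 0 :=
  Function.extend_apply' _ _ _ fun ⟨c, hc⟩ => ha (hc ▸ c.2)

theorem indicator_extendByZero (φ : C(C, B)) :
    C.indicator (extendByZero φ) = extendByZero φ := by
  rw [Set.indicator_eq_self, Function.support_subset_iff']
  exact fun a ha => extendByZero_of_notMem φ ha

theorem norm_extendByZero_le [CompactSpace C] (φ : C(C, B)) (a : G) :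
    ‖extendByZero φ a‖ ≤ ‖φ‖ := by
  by_cases ha : a ∈ C
  · exact (extendByZero_apply_coe φ ⟨a, ha⟩).symm ▸ φ.norm_coe_le_norm _
  · rw [extendByZero_of_notMem φ ha, norm_zero]
    exact norm_nonneg φ

theorem extendByZero_sub (φ φ' : C(C, B)) :
    extendByZero (φ - φ') = extendByZero φ - extendByZero φ' := by
  ext a
  by_cases ha : a ∈ C
  · simp only [Pi.sub_apply, extendByZero_apply_coe _ ⟨a, ha⟩, ContinuousMap.sub_apply]
  · simp only [Pi.sub_apply, extendByZero_of_notMem _ ha, sub_zero]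

theorem continuousOn_extendByZero (φ : C(C, B)) : ContinuousOn (extendByZero φ) C := by
  rw [continuousOn_iff_continuous_domRestrict]
  exact φ.continuous.congr fun a => (extendByZero_apply_coe φ a).symm

theorem integrable_extendByZero [MeasurableSpace G] [OpensMeasurableSpace G] [T2Space G]
    {ν : Measure G} [IsFiniteMeasureOnCompacts ν] (hC : IsCompact C) (φ : C(C, B)) :
    Integrable (extendByZero φ) ν := by
  rw [← indicator_extendByZero φ, integrable_indicator_iff hC.measurableSet]
  exact (continuousOn_extendByZero φ).integrableOn_compact hC

variable [NormedSpace ℝ B]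

theorem tendsto_sampleMean_extendByZero [CompactSpace C] {s : ℕ → Finset ι} {x : ι → G}
    {φ : ℕ → C(C, B)} {φ' : C(C, B)} {m : B} (hφ : Tendsto φ atTop (𝓝 φ'))
    (hm : Tendsto (fun n => sampleMean (s n) x (extendByZero φ')) atTop (𝓝 m)) :
    Tendsto (fun n => sampleMean (s n) x (extendByZero (φ n))) atTop (𝓝 m) := by
  refine hm.congr_dist (squeeze_zero (fun _ => dist_nonneg) (fun n => ?_)
    (tendsto_iff_norm_sub_tendsto_zero.1 hφ))
  rw [dist_eq_norm', ← map_sub, ← extendByZero_sub]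
  exact norm_sampleMean_le_of_norm_le (norm_nonneg _) (norm_extendByZero_le _) _ _

end ExtendByZero

theorem tendsto_of_tendsto_of_dist_le {ι κ M : Type*} [PseudoMetricSpace M] {l : Filter ι}
    {l' : Filter κ} [l'.NeBot] {u : ι → M} {a : M} {v : κ → ι → M} {b : κ → M} {r : κ → ι → ℝ}
    {e : κ → ℝ} (hv : ∀ m, Tendsto (v m) l (𝓝 (b m))) (hr : ∀ m, Tendsto (r m) l (𝓝 (e m)))
    (huv : ∀ m n, dist (u n) (v m n) ≤ r m n) (hba : ∀ m, dist (b m) a ≤ e m)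
    (he : Tendsto e l' (𝓝 0)) : Tendsto u l (𝓝 a) := by
  refine tendsto_iff_dist_tendsto_zero.2 (tendsto_order.2
    ⟨fun c hc => Eventually.of_forall fun n => hc.trans_le dist_nonneg, fun ε hε => ?_⟩)
  have he0 : Tendsto (fun m => e m + 0 + e m) l' (𝓝 0) := by
    simpa only [add_zero] using (he.add_const 0).add he
  obtain ⟨m, hm⟩ := (he0.eventually_lt_const hε).exists
  have hbound := ((hr m).add (tendsto_iff_dist_tendsto_zero.1 (hv m))).add_const (e m)
  filter_upwards [hbound.eventually_lt_const hm] with n hn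
  exact ((dist_triangle4 _ _ _ _).trans
    (add_le_add_three (huv m n) le_rfl (hba m))).trans_lt hn

theorem innerRegularCompactLTTop_of_locallyCompactSpace {G : Type*} [TopologicalSpace G] [T2Space G]
    [SecondCountableTopology G] [LocallyCompactSpace G] [MeasurableSpace G] [BorelSpace G]
    (ν : Measure G) [IsFiniteMeasure ν] : ν.InnerRegularCompactLTTop := by
  have : TopologicalSpace.MetrizableSpace G :=
    TopologicalSpace.metrizableSpace_of_t3_secondCountable G
  let _ := TopologicalSpace.metrizableSpaceMetric G
  infer_instance

section Truncation

variable {G ι B : Type*} [NormedAddCommGroup B] {V : G × G → B} {s : G → ℝ}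

theorem norm_sub_indicator_prod_le (hle : ∀ z, ‖V z‖ ≤ s z.1 * s z.2) (C : Set G) (z : G × G) :
    ‖(V - (C ×ˢ C).indicator V) z‖
      ≤ s z.1 * s z.2 - C.indicator s z.1 * C.indicator s z.2 := by
  by_cases h1 : z.1 ∈ C <;> by_cases h2 : z.2 ∈ C <;> simp [Set.indicator, h1, h2, hle]

theorem norm_sampleMean_sub_indicator_prod_le [NormedSpace ℝ B]
    (hle : ∀ z, ‖V z‖ ≤ s z.1 * s z.2) (C : Set G) (t : Finset ι) (x : ι → G) :
    ‖sampleMean (t ×ˢ t) (Prod.map x x) V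
        - sampleMean (t ×ˢ t) (Prod.map x x) ((C ×ˢ C).indicator V)‖
      ≤ sampleMean t x s ^ 2 - sampleMean t x (C.indicator s) ^ 2 := by
  rw [← map_sub]
  refine (norm_sampleMean_le (norm_sub_indicator_prod_le hle C) _ _).trans_eq ?_
  rw [sq, sq, ← sampleMean_product_mul, ← sampleMean_product_mul, ← map_sub]
  rfl

variable [MeasurableSpace G] {ν : Measure G}

theorem norm_integral_sub_setIntegral_le [NormedSpace ℝ B] [SFinite ν]
    (hV : Integrable V (ν.prod ν)) (hs : Integrable s ν) (hle : ∀ z, ‖V z‖ ≤ s z.1 * s z.2)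
    {C : Set G} (hC : MeasurableSet C) :
    ‖∫ z, V z ∂ν.prod ν - ∫ z in C ×ˢ C, V z ∂ν.prod ν‖
      ≤ (∫ x, s x ∂ν) ^ 2 - (∫ x in C, s x ∂ν) ^ 2 := by
  have hsC : Integrable (C.indicator s) ν := hs.indicator hC
  calc ‖∫ z, V z ∂ν.prod ν - ∫ z in C ×ˢ C, V z ∂ν.prod ν‖
      = ‖∫ z, (V - (C ×ˢ C).indicator V) z ∂ν.prod ν‖ := by
        rw [integral_sub' hV (hV.indicator (hC.prod hC)), integral_indicator (hC.prod hC)]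
    _ ≤ ∫ z, s z.1 * s z.2 - C.indicator s z.1 * C.indicator s z.2 ∂ν.prod ν :=
        norm_integral_le_of_norm_le ((hs.mul_prod hs).sub (hsC.mul_prod hsC))
          (Eventually.of_forall (norm_sub_indicator_prod_le hle C))
    _ = _ := by
        rw [integral_sub (hs.mul_prod hs) (hsC.mul_prod hsC), integral_prod_mul, integral_prod_mul,
          integral_indicator hC, sq, sq]

variable [TopologicalSpace G] {A : Set G}

theorem integrable_of_continuousOn_of_norm_le [BorelSpace G] [SecondCountableTopology G]
    (hA : MeasurableSet A) (hνA : ν Aᶜ = 0) {f : G → B} (hf : ContinuousOn f A)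
    (hs : Integrable s ν) (hle : ∀ x, ‖f x‖ ≤ s x) : Integrable f ν := by
  refine hs.mono' ?_ (Eventually.of_forall hle)
  rw [← Measure.restrict_eq_self_of_ae_mem (ae_iff.2 hνA)]
  exact hf.aestronglyMeasurable hA

theorem exists_seq_isCompact_tendsto_setIntegral [T2Space G] [OpensMeasurableSpace G]
    [IsFiniteMeasure ν] [ν.InnerRegularCompactLTTop] [NormedSpace ℝ B]
    (hA : MeasurableSet A) (hνA : ν Aᶜ = 0) {f : G → B} (hf : Integrable f ν) :
    ∃ C : ℕ → Set G, (∀ m, IsCompact (C m) ∧ C m ⊆ A) ∧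
      Tendsto (fun m => ∫ x in C m, f x ∂ν) atTop (𝓝 (∫ x, f x ∂ν)) := by
  choose C hCA hC hlt using fun m : ℕ => hA.exists_isCompact_sdiff_lt (measure_ne_top ν A)
    (ENNReal.inv_ne_zero.2 (ENNReal.natCast_ne_top m))
  have hcompl : ∀ m, ν (C m)ᶜ = ν (A \ C m) := fun m => by
    rw [Set.sdiff_eq, Set.inter_comm, measure_inter_conull hνA]
  have hsmall : Tendsto (fun m => ∫ x in (C m)ᶜ, f x ∂ν) atTop (𝓝 0) :=
    hf.tendsto_setIntegral_nhds_zero (tendsto_of_tendsto_of_tendsto_of_le_of_le tendsto_const_nhds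
      ENNReal.tendsto_inv_nat_nhds_zero (fun _ => bot_le) fun m => (hcompl m).trans_le (hlt m).le)
  refine ⟨C, fun m => ⟨hC m, hCA m⟩, ?_⟩
  refine (sub_zero (∫ x, f x ∂ν) ▸ hsmall.const_sub (∫ x, f x ∂ν)).congr fun m => ?_
  exact sub_eq_of_eq_add (integral_add_compl (hC m).measurableSet hf).symm

end Truncation

section VStatistic

open Finset (range)

variable {G B : Type*} [TopologicalSpace G] [NormedAddCommGroup B] {C : Set G} [CompactSpace C]
  {V : G × G → B}

/-- For a kernel `V` continuous on a compact square `C ×ˢ C`, the continuous family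
`b ↦ V (·, b)` of its sections. -/
def kernelSections (hV : ContinuousOn V (C ×ˢ C)) : C(C, C(C, B)) :=
  ContinuousMap.curry ⟨fun z : C × C => V (z.2, z.1),
    hV.comp_continuous (by fun_prop) fun z => ⟨z.2.2, z.1.2⟩⟩

theorem indicator_prod_eq_extendByZero (hV : ContinuousOn V (C ×ˢ C)) (a : C) (b : G) :
    (C ×ˢ C).indicator V (a, b) = (extendByZero (kernelSections hV) b : C(C, B)) a := by
  by_cases hb : b ∈ C
  · rw [Set.indicator_of_mem (Set.mk_mem_prod a.2 hb), extendByZero_apply_coe _ ⟨b, hb⟩]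
    rfl
  · rw [Set.indicator_of_notMem (fun h => hb h.2), extendByZero_of_notMem _ hb]
    rfl

variable [NormedSpace ℝ B]

theorem sampleMean_indicator_prod {ι : Type*} (hV : ContinuousOn V (C ×ˢ C)) (s : Finset ι)
    (x : ι → G) :
    sampleMean (s ×ˢ s) (Prod.map x x) ((C ×ˢ C).indicator V)
      = sampleMean s x (extendByZero (sampleMean s x (extendByZero (kernelSections hV)))) := by
  rw [sampleMean_product]
  congr 1
  ext a
  by_cases ha : a ∈ C
  · rw [extendByZero_apply_coe _ ⟨a, ha⟩, ← ContinuousMap.evalCLM_apply ℝ, map_sampleMean]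
    simp only [ContinuousMap.evalCLM_apply, ← indicator_prod_eq_extendByZero hV ⟨a, ha⟩]
  · simp only [Set.indicator_of_notMem (fun h : (a, _) ∈ C ×ˢ C => ha h.1),
      extendByZero_of_notMem _ ha]
    exact map_zero _

variable [T2Space G] [SecondCountableTopology G] [MeasurableSpace G] {ν : Measure G}
  [IsFiniteMeasure ν] [CompleteSpace B]

theorem integral_extendByZero_integral [OpensMeasurableSpace G] (hV : ContinuousOn V (C ×ˢ C)) :
    ∫ a, extendByZero (∫ b, extendByZero (kernelSections hV) b ∂ν) a ∂ν
      = ∫ z in C ×ˢ C, V z ∂ν.prod ν := by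
  have hC : IsCompact C := isCompact_iff_compactSpace.2 ‹_›
  rw [setIntegral_prod _ (hV.integrableOn_compact (hC.prod hC)), ← indicator_extendByZero,
    integral_indicator hC.measurableSet]
  refine setIntegral_congr_fun hC.measurableSet fun a ha => ?_
  rw [extendByZero_apply_coe _ ⟨a, ha⟩,
    ContinuousMap.integral_apply (integrable_extendByZero hC (kernelSections hV)),
    ← integral_indicator hC.measurableSet]
  congr 1
  ext b
  rw [← indicator_prod_eq_extendByZero hV ⟨a, ha⟩]
  by_cases hb : b ∈ C <;> simp [ha, hb]

variable {Ω : Type*} [MeasurableSpace Ω] {P : Measure Ω} {X : ℕ → Ω → G}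

theorem ae_tendsto_sampleMean_indicator_prod [OpensMeasurableSpace G]
    (hX : ∀ i, HasLaw (X i) ν P) (hind : Pairwise fun i j => X i ⟂ᵢ[P] X j)
    (hV : ContinuousOn V (C ×ˢ C)) :
    ∀ᵐ ξ ∂P, Tendsto (fun n => sampleMean (range n ×ˢ range n) (Prod.map (X · ξ) (X · ξ))
      ((C ×ˢ C).indicator V)) atTop (𝓝 (∫ z in C ×ˢ C, V z ∂ν.prod ν)) := by
  have hC : IsCompact C := isCompact_iff_compactSpace.2 ‹_›
  filter_upwards [ae_tendsto_sampleMean hX hind (integrable_extendByZero hC (kernelSections hV)),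
    ae_tendsto_sampleMean hX hind (integrable_extendByZero hC
      (∫ b, extendByZero (kernelSections hV) b ∂ν))] with ξ hsections hmean
  rw [integral_extendByZero_integral hV] at hmean
  simp only [sampleMean_indicator_prod hV]
  exact tendsto_sampleMean_extendByZero hsections hmean

theorem ae_tendsto_sampleMean_prod [BorelSpace G] [ν.InnerRegularCompactLTTop]
    (hX : ∀ i, HasLaw (X i) ν P) (hind : Pairwise fun i j => X i ⟂ᵢ[P] X j) {A : Set G}
    (hA : MeasurableSet A) (hνA : ν Aᶜ = 0) (hV : ContinuousOn V (A ×ˢ A))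
    {s : G → ℝ} (hs : Integrable s ν) (hle : ∀ z, ‖V z‖ ≤ s z.1 * s z.2) :
    ∀ᵐ ξ ∂P, Tendsto (fun n => sampleMean (range n ×ˢ range n) (Prod.map (X · ξ) (X · ξ)) V)
      atTop (𝓝 (∫ z, V z ∂ν.prod ν)) := by
  obtain ⟨C, hC, hCs⟩ := exists_seq_isCompact_tendsto_setIntegral hA hνA hs
  have hCV : ∀ m, ContinuousOn V (C m ×ˢ C m) := fun m =>
    hV.mono (Set.prod_mono (hC m).2 (hC m).2)
  have hCm := fun m => (hC m).1.measurableSet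
  have hVint : Integrable V (ν.prod ν) := integrable_of_continuousOn_of_norm_le (hA.prod hA)
    (Measure.measure_prod_compl_eq_zero hνA hνA) hV (hs.mul_prod hs) hle
  have : ∀ m, CompactSpace (C m) := fun m => isCompact_iff_compactSpace.1 (hC m).1
  filter_upwards [ae_tendsto_sampleMean hX hind hs,
    ae_all_iff.2 fun m => ae_tendsto_sampleMean hX hind (hs.indicator (hCm m)),
    ae_all_iff.2 fun m => ae_tendsto_sampleMean_indicator_prod hX hind (hCV m)]
    with ξ hmean hmeanC hVC
  refine tendsto_of_tendsto_of_dist_le (l' := atTop) hVC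
    (fun m => (hmean.pow 2).sub ((hmeanC m).pow 2)) (fun m n => ?_) (fun m => ?_) ?_
  · rw [dist_eq_norm]
    exact norm_sampleMean_sub_indicator_prod_le hle (C m) _ _
  · rw [dist_eq_norm', integral_indicator (hCm m)]
    exact norm_integral_sub_setIntegral_le hVint hs hle (hCm m)
  · simp only [integral_indicator (hCm _)]
    exact sub_self ((∫ x, s x ∂ν) ^ 2) ▸ (hCs.pow 2).const_sub _

end VStatistic

section InnerProduct

variable {F : Type*} [NormedAddCommGroup F] [InnerProductSpace ℝ F]

theorem continuousOn_of_continuousOn_inner {Z : Type*} [TopologicalSpace Z] {A : Set Z} {ψ : Z → F}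
    (h : ContinuousOn (fun z : Z × Z => ⟪ψ z.1, ψ z.2⟫) (A ×ˢ A)) : ContinuousOn ψ A := by
  intro x hx
  have hself : ContinuousOn (fun z => ⟪ψ z, ψ z⟫) A :=
    h.comp (f := fun z => (z, z)) (by fun_prop) fun z hz => ⟨hz, hz⟩
  have hright : ContinuousOn (fun z => ⟪ψ z, ψ x⟫) A :=
    h.comp (f := fun z => (z, x)) (by fun_prop) fun z hz => ⟨hz, hx⟩
  have hsq : Tendsto (fun z => ‖ψ z - ψ x‖ ^ 2) (𝓝[A] x) (𝓝 0) := by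
    have := ((hself x hx).tendsto.sub ((hright x hx).tendsto.const_mul 2)).add_const ⟪ψ x, ψ x⟫
    rw [two_mul, sub_add_cancel_left, neg_add_cancel] at this
    refine this.congr fun z => ?_
    rw [norm_sub_sq_real, real_inner_self_eq_norm_sq, real_inner_self_eq_norm_sq]
  rw [ContinuousWithinAt, tendsto_iff_norm_sub_tendsto_zero]
  simpa only [Real.sqrt_sq (norm_nonneg _), Real.sqrt_zero] using hsq.sqrt

theorem isGreatest_inner_closedBall (m : F) :
    IsGreatest {r : ℝ | ∃ f : F, ‖f‖ ≤ 1 ∧ r = ⟪f, m⟫} ‖m‖ := by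
  refine ⟨⟨‖m‖⁻¹ • m, ?_, ?_⟩, ?_⟩
  · rw [norm_smul, norm_inv, norm_norm]
    exact inv_mul_le_one
  · rw [real_inner_smul_left, real_inner_self_eq_norm_mul_norm, ← mul_assoc, inv_mul_mul_self]
  · rintro _ ⟨f, hf, rfl⟩
    exact (real_inner_le_norm f m).trans (mul_le_of_le_one_left (norm_nonneg m) hf)

end InnerProduct

section GramFamily

variable {T G F : Type*} [TopologicalSpace T] [NormedAddCommGroup F] [InnerProductSpace ℝ F]
  {Ψ : T → G → F}

/-- The Gram kernels of a family of feature maps `Ψ t` on `G`, as one kernel on `G` with values in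
the continuous functions of `t`: uniform statements in `t` about the kernels are statements about
this single Banach-space-valued kernel. -/
def gramMap (hΨ : ∀ z : G × G, Continuous fun t => ⟪Ψ t z.1, Ψ t z.2⟫) (z : G × G) : C(T, ℝ) :=
  ⟨fun t => ⟪Ψ t z.1, Ψ t z.2⟫, hΨ z⟩

section Norm

variable [CompactSpace T] {hΨ : ∀ z : G × G, Continuous fun t => ⟪Ψ t z.1, Ψ t z.2⟫}

theorem norm_gramMap_self (x : G) : ‖gramMap hΨ (x, x)‖ = ⨆ t, ⟪Ψ t x, Ψ t x⟫ := by
  rw [ContinuousMap.norm_eq_iSup_norm]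
  exact iSup_congr fun t => Real.norm_of_nonneg real_inner_self_nonneg

theorem norm_le_sqrt_norm_gramMap (t : T) (x : G) : ‖Ψ t x‖ ≤ √‖gramMap hΨ (x, x)‖ := by
  refine Real.le_sqrt_of_sq_le ?_
  rw [← real_inner_self_eq_norm_sq]
  exact (Real.le_norm_self _).trans ((gramMap hΨ (x, x)).norm_coe_le_norm t)

theorem norm_gramMap_le (z : G × G) :
    ‖gramMap hΨ z‖ ≤ √‖gramMap hΨ (z.1, z.1)‖ * √‖gramMap hΨ (z.2, z.2)‖ := by
  refine (ContinuousMap.norm_le _ (by positivity)).2 fun t => (norm_inner_le_norm _ _).trans ?_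
  gcongr <;> exact norm_le_sqrt_norm_gramMap t _

end Norm

variable [TopologicalSpace G] {A : Set G}

theorem continuous_inner_of_continuousOn (h0 : ∀ t, ∀ x ∉ A, Ψ t x = 0)
    (h : ContinuousOn (fun z : T × G × G => ⟪Ψ z.1 z.2.1, Ψ z.1 z.2.2⟫)
      {z | z.2.1 ∈ A ∧ z.2.2 ∈ A}) (z : G × G) : Continuous fun t => ⟪Ψ t z.1, Ψ t z.2⟫ := by
  by_cases h1 : z.1 ∈ A
  · by_cases h2 : z.2 ∈ A
    · exact h.comp_continuous (f := fun t => (t, z)) (by fun_prop) fun _ => ⟨h1, h2⟩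
    · simp only [h0 _ _ h2, inner_zero_right, continuous_const]
  · simp only [h0 _ _ h1, inner_zero_left, continuous_const]

theorem continuousOn_gramMap {hΨ : ∀ z : G × G, Continuous fun t => ⟪Ψ t z.1, Ψ t z.2⟫}
    (h : ContinuousOn (fun z : T × G × G => ⟪Ψ z.1 z.2.1, Ψ z.1 z.2.2⟫)
      {z | z.2.1 ∈ A ∧ z.2.2 ∈ A}) : ContinuousOn (gramMap hΨ) (A ×ˢ A) := by
  rw [continuousOn_iff_continuous_domRestrict]
  exact ContinuousMap.continuous_of_continuous_uncurry _ <|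
    h.comp_continuous (f := fun z : (A ×ˢ A : Set (G × G)) × T => (z.2, z.1.1)) (by fun_prop)
      fun z => z.1.2

end GramFamily

theorem integral_inner_prod {G F : Type*} [MeasurableSpace G] {ν : Measure G} [SFinite ν]
    [NormedAddCommGroup F] [InnerProductSpace ℝ F] [CompleteSpace F] {ψ : G → F}
    (hψ : Integrable ψ ν) : ∫ z, ⟪ψ z.1, ψ z.2⟫ ∂ν.prod ν = ‖∫ x, ψ x ∂ν‖ ^ 2 := by
  rw [← real_inner_self_eq_norm_sq]
  exact integral_prod_bilin (innerSL ℝ) hψ hψ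

theorem integrable_sqrt {G : Type*} [MeasurableSpace G] {ν : Measure G} [IsFiniteMeasure ν]
    {f : G → ℝ} (hf : Integrable f ν) : Integrable (fun x => √(f x)) ν := by
  refine (hf.norm.add (integrable_const 1)).mono'
    (Real.continuous_sqrt.comp_aestronglyMeasurable hf.aestronglyMeasurable)
    (Eventually.of_forall fun x => ?_)
  rw [Real.norm_of_nonneg (Real.sqrt_nonneg _), Pi.add_apply, Real.sqrt_le_left (by positivity)]
  nlinarith [norm_nonneg (f x), Real.le_norm_self (f x)]

/-- The families of feature maps `Ψ t` on `G` whose means and V-statistics are controlled uniformly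
in `t`: they vanish off the set `A` carrying `ν`, their Gram kernels are jointly continuous over
`A`, and the diagonals of these kernels have an integrable supremum. -/
structure IsDominatedFeatureFamily {T G F : Type*} [TopologicalSpace T] [TopologicalSpace G]
    [MeasurableSpace G] [NormedAddCommGroup F] [InnerProductSpace ℝ F] (ν : Measure G) (A : Set G)
    (Ψ : T → G → F) : Prop where
  measurableSet : MeasurableSet A
  measure_compl : ν Aᶜ = 0
  eq_zero : ∀ t, ∀ x ∉ A, Ψ t x = 0
  continuousOn_inner : ContinuousOn (fun z : T × G × G => ⟪Ψ z.1 z.2.1, Ψ z.1 z.2.2⟫)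
    {z | z.2.1 ∈ A ∧ z.2.2 ∈ A}
  integrable_iSup : Integrable (fun x => ⨆ t, ⟪Ψ t x, Ψ t x⟫) ν

namespace IsDominatedFeatureFamily

variable {T G F : Type*} [TopologicalSpace T] [TopologicalSpace G] [MeasurableSpace G]
  [NormedAddCommGroup F] [InnerProductSpace ℝ F] {ν : Measure G} {A : Set G} {Ψ : T → G → F}

theorem continuous_inner (h : IsDominatedFeatureFamily ν A Ψ) (z : G × G) :
    Continuous fun t => ⟪Ψ t z.1, Ψ t z.2⟫ :=
  continuous_inner_of_continuousOn h.eq_zero h.continuousOn_inner z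

variable [CompactSpace T] [IsFiniteMeasure ν]

theorem integrable_sqrt_norm_gramMap (h : IsDominatedFeatureFamily ν A Ψ) :
    Integrable (fun x => √‖gramMap h.continuous_inner (x, x)‖) ν := by
  simp only [norm_gramMap_self]
  exact integrable_sqrt h.integrable_iSup

variable [BorelSpace G] [SecondCountableTopology G]

theorem integrable (h : IsDominatedFeatureFamily ν A Ψ) (t : T) : Integrable (Ψ t) ν :=
  integrable_of_continuousOn_of_norm_le h.measurableSet h.measure_compl
    (continuousOn_of_continuousOn_inner <|
      h.continuousOn_inner.comp (f := fun z : G × G => (t, z)) (by fun_prop) fun _ hz => hz)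
    h.integrable_sqrt_norm_gramMap (norm_le_sqrt_norm_gramMap t)

theorem integrable_gramMap (h : IsDominatedFeatureFamily ν A Ψ) :
    Integrable (gramMap h.continuous_inner) (ν.prod ν) :=
  integrable_of_continuousOn_of_norm_le (h.measurableSet.prod h.measurableSet)
    (Measure.measure_prod_compl_eq_zero h.measure_compl h.measure_compl)
    (continuousOn_gramMap h.continuousOn_inner)
    (h.integrable_sqrt_norm_gramMap.mul_prod h.integrable_sqrt_norm_gramMap) norm_gramMap_le

variable [CompleteSpace F]

theorem integral_gramMap (h : IsDominatedFeatureFamily ν A Ψ) (t : T) :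
    (∫ z, gramMap h.continuous_inner z ∂ν.prod ν) t = ‖∫ x, Ψ t x ∂ν‖ ^ 2 := by
  rw [ContinuousMap.integral_apply h.integrable_gramMap, ← integral_inner_prod (h.integrable t)]
  rfl

theorem continuous_norm_integral (h : IsDominatedFeatureFamily ν A Ψ) :
    Continuous fun t => ‖∫ x, Ψ t x ∂ν‖ :=
  (∫ z, gramMap h.continuous_inner z ∂ν.prod ν).continuous.sqrt.congr fun t => by
    rw [h.integral_gramMap, Real.sqrt_sq (norm_nonneg _)]

variable [T2Space G] [ν.InnerRegularCompactLTTop] {Ω : Type*} [MeasurableSpace Ω] {P : Measure Ω}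
  {X : ℕ → Ω → G}

open Finset (range)

theorem ae_tendstoUniformly_sampleMean_inner (h : IsDominatedFeatureFamily ν A Ψ)
    (hX : ∀ i, HasLaw (X i) ν P) (hind : Pairwise fun i j => X i ⟂ᵢ[P] X j) :
    ∀ᵐ ξ ∂P, TendstoUniformly
      (fun n t => sampleMean (range n ×ˢ range n) (Prod.map (X · ξ) (X · ξ))
        fun z => ⟪Ψ t z.1, Ψ t z.2⟫)
      (fun t => ‖∫ x, Ψ t x ∂ν‖ ^ 2) atTop := by
  filter_upwards [ae_tendsto_sampleMean_prod hX hind h.measurableSet h.measure_compl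
    (continuousOn_gramMap h.continuousOn_inner) h.integrable_sqrt_norm_gramMap norm_gramMap_le]
    with ξ hξ
  rw [ContinuousMap.tendsto_iff_tendstoUniformly] at hξ
  simp only [← h.integral_gramMap]
  convert hξ using 3 with n t
  exact (map_sampleMean (ContinuousMap.evalCLM ℝ t) _ _ (gramMap h.continuous_inner)).symm

end IsDominatedFeatureFamily

section Density

variable {G : Type*} [MeasurableSpace G] {μ : Measure G} {w : G → ℝ}

theorem IsProbDensity.isProbabilityMeasure_distr (hw : IsProbDensity μ w) :
    IsProbabilityMeasure (distr μ w) :=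
  ⟨by rw [distr, withDensity_apply _ .univ, Measure.restrict_univ, hw.lintegral_eq_one]⟩

theorem IsProbDensity.measurableSet_pos (hw : IsProbDensity μ w) : MeasurableSet {x | 0 < w x} :=
  measurableSet_lt measurable_const hw.measurable

theorem IsProbDensity.eq_zero_of_notMem_pos (hw : IsProbDensity μ w) {x : G}
    (hx : x ∉ {x | 0 < w x}) : w x = 0 :=
  le_antisymm (not_lt.1 hx) (hw.nonneg x)

theorem IsProbDensity.distr_compl_pos (hw : IsProbDensity μ w) : distr μ w {x | 0 < w x}ᶜ = 0 := by
  rw [distr, withDensity_apply_eq_zero hw.measurable.ennreal_ofReal]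
  convert measure_empty (μ := μ)
  ext x
  simp

theorem IsProbDensity.integrable_distr_iff (hw : IsProbDensity μ w) {f : G → ℝ} :
    Integrable f (distr μ w) ↔ Integrable (fun x => w x * f x) μ := by
  rw [distr, integrable_withDensity_iff_integrable_smul' hw.measurable.ennreal_ofReal
    (Eventually.of_forall fun _ => ENNReal.ofReal_lt_top)]
  simp only [ENNReal.toReal_ofReal (hw.nonneg _), smul_eq_mul]

theorem IsProbDensity.integral_distr (hw : IsProbDensity μ w) (f : G → ℝ) :
    ∫ x, f x ∂(distr μ w) = ∫ x, w x * f x ∂μ := by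
  rw [distr, integral_withDensity_eq_integral_toReal_smul hw.measurable.ennreal_ofReal
    (Eventually.of_forall fun _ => ENNReal.ofReal_lt_top)]
  simp only [ENNReal.toReal_ofReal (hw.nonneg _), smul_eq_mul]

end Density

section Discrepancy

open Finset (range)

variable {E : Type*} [NormedAddCommGroup E] [NormedSpace ℝ E] [FiniteDimensional ℝ E]
  {G : Type*} [TopologicalSpace G] [ChartedSpace E G] [Group G] [LieGroup 𝓘(ℝ, E) ∞ G]
  {H : Type*} [NormedAddCommGroup H] [InnerProductSpace ℝ H] [RKHS ℝ H G ℝ]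
  {d : ℕ} {b : Module.Basis (Fin d) ℝ (GroupLieAlgebra 𝓘(ℝ, E) G)} {p q w : G → ℝ}

theorem wksdSq_eq_sampleMean [CompleteSpace H] (n : ℕ) (x : ℕ → G) :
    wksdSq H b p q w n x = sampleMean (range n ×ˢ range n) (Prod.map x x)
      fun z => weightedKernel H b p q w z.1 z.2 := by
  simp only [wksdSq, sampleMean_apply, Finset.card_product, Finset.card_range,
    Finset.sum_product, Prod.map_apply, Nat.cast_mul, one_div, smul_eq_mul, sq]

variable [MeasurableSpace G] {μ : Measure G} {Φ : G → PiLp 2 fun _ : Fin d => H}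

theorem IsSteinFeature.integrable_steinOpVec_mul (hΦ : IsSteinFeature b p Φ)
    (hw : IsProbDensity μ w) (hqw : ∀ᵐ x ∂μ, w x = 0 → q x = 0)
    (hint : Integrable (weightedFeature q w Φ) (distr μ w)) (f : PiLp 2 fun _ : Fin d => H) :
    Integrable (fun x => steinOpVec b p f x * q x) μ :=
  (hw.integrable_distr_iff.1 (hint.const_inner f)).congr <|
    hqw.mono fun _ hx => (hΦ.steinOpVec_mul_eq f hx).symm

variable [CompleteSpace H]

theorem IsSteinFeature.integral_steinOpVec_mul (hΦ : IsSteinFeature b p Φ)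
    (hw : IsProbDensity μ w) (hqw : ∀ᵐ x ∂μ, w x = 0 → q x = 0)
    (hint : Integrable (weightedFeature q w Φ) (distr μ w)) (f : PiLp 2 fun _ : Fin d => H) :
    ∫ x, steinOpVec b p f x * q x ∂μ = ⟪f, ∫ x, weightedFeature q w Φ x ∂distr μ w⟫ := by
  rw [← integral_inner hint, hw.integral_distr]
  exact integral_congr_ae (hqw.mono fun _ hx => hΦ.steinOpVec_mul_eq f hx)

theorem IsSteinFeature.isGreatest_integral_steinOpVec_mul (hΦ : IsSteinFeature b p Φ)
    (hw : IsProbDensity μ w) (hqw : ∀ᵐ x ∂μ, w x = 0 → q x = 0)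
    (hint : Integrable (weightedFeature q w Φ) (distr μ w)) :
    IsGreatest {r : ℝ | ∃ f : PiLp 2 (fun _ : Fin d => H), ‖f‖ ≤ 1 ∧
      r = ∫ x, steinOpVec b p f x * q x ∂μ} ‖∫ x, weightedFeature q w Φ x ∂distr μ w‖ := by
  simp only [hΦ.integral_steinOpVec_mul hw hqw hint]
  exact isGreatest_inner_closedBall _

theorem IsSteinFeature.ksd_eq_norm_integral (hΦ : IsSteinFeature b p Φ)
    (hw : IsProbDensity μ w) (hqw : ∀ᵐ x ∂μ, w x = 0 → q x = 0)
    (hint : Integrable (weightedFeature q w Φ) (distr μ w)) :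
    ksd H b μ p q = ‖∫ x, weightedFeature q w Φ x ∂distr μ w‖ :=
  (hΦ.isGreatest_integral_steinOpVec_mul hw hqw hint).csSup_eq

end Discrepancy

section SteinFamily

variable {E : Type*} [NormedAddCommGroup E] [NormedSpace ℝ E] [FiniteDimensional ℝ E]
  {G : Type*} [TopologicalSpace G] [ChartedSpace E G] [Group G] [LieGroup 𝓘(ℝ, E) ∞ G]
  {H : Type*} [NormedAddCommGroup H] [InnerProductSpace ℝ H] [CompleteSpace H] [RKHS ℝ H G ℝ]
  {d : ℕ} {b : Module.Basis (Fin d) ℝ (GroupLieAlgebra 𝓘(ℝ, E) G)} {q w : G → ℝ}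
  {Θ : Type*} [TopologicalSpace Θ] {p : Θ → G → ℝ} {Φ : Θ → G → PiLp 2 fun _ : Fin d => H}

theorem continuousOn_inner_weightedFeature (hΦ : ∀ θ, IsSteinFeature b (p θ) (Φ θ))
    (hV : ContinuousOn (fun z : Θ × G × G => weightedKernel H b (p z.1) q w z.2.1 z.2.2)
      {z | 0 < w z.2.1 ∧ 0 < w z.2.2}) :
    ContinuousOn (fun z : Θ × G × G =>
        ⟪weightedFeature q w (Φ z.1) z.2.1, weightedFeature q w (Φ z.1) z.2.2⟫)
      {z | 0 < w z.2.1 ∧ 0 < w z.2.2} := by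
  simpa only [(hΦ _).weightedKernel_eq_inner] using hV

theorem continuous_wksd (hΦ : ∀ θ, IsSteinFeature b (p θ) (Φ θ)) (hw : ∀ x, 0 ≤ w x)
    (hV : ContinuousOn (fun z : Θ × G × G => weightedKernel H b (p z.1) q w z.2.1 z.2.2)
      {z | 0 < w z.2.1 ∧ 0 < w z.2.2}) (n : ℕ) (x : ℕ → G) :
    Continuous fun θ => wksd H b (p θ) q w n x := by
  simp only [wksd, wksdSq_eq_sampleMean, sampleMean_apply, (hΦ _).weightedKernel_eq_inner]
  refine ((continuous_finsetSum _ fun _ _ => ?_).fun_const_smul _).sqrt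
  exact continuous_inner_of_continuousOn (A := {x | 0 < w x})
    (fun _ _ hx => weightedFeature_of_eq_zero (le_antisymm (not_lt.1 hx) (hw _)))
    (continuousOn_inner_weightedFeature hΦ hV) _

variable [MeasurableSpace G] {μ : Measure G}

theorem isDominatedFeatureFamily_weightedFeature (hΦ : ∀ θ, IsSteinFeature b (p θ) (Φ θ))
    (hw : IsProbDensity μ w)
    (hV : ContinuousOn (fun z : Θ × G × G => weightedKernel H b (p z.1) q w z.2.1 z.2.2)
      {z | 0 < w z.2.1 ∧ 0 < w z.2.2}) {K : Set Θ}
    (hK : Integrable (fun x => ⨆ θ : K, weightedKernel H b (p θ) q w x x) (distr μ w)) :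
    IsDominatedFeatureFamily (distr μ w) {x | 0 < w x} fun θ : K => weightedFeature q w (Φ θ) where
  measurableSet := hw.measurableSet_pos
  measure_compl := hw.distr_compl_pos
  eq_zero _ _ hx := weightedFeature_of_eq_zero (hw.eq_zero_of_notMem_pos hx)
  continuousOn_inner := (continuousOn_inner_weightedFeature hΦ hV).comp
    (f := fun z : K × G × G => ((z.1 : Θ), z.2)) (by fun_prop) fun _ hz => hz
  integrable_iSup := by simpa only [(hΦ _).weightedKernel_eq_inner] using hK

end SteinFamily

end LieKSD

open LieKSD in
theorem theorem4p2_general {E : Type*} [NormedAddCommGroup E] [NormedSpace ℝ E]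
    [FiniteDimensional ℝ E] {G : Type*} [TopologicalSpace G] [T2Space G]
    [SecondCountableTopology G] [ChartedSpace E G] [Group G] [LieGroup 𝓘(ℝ, E) ∞ G]
    {d : ℕ} (b : Module.Basis (Fin d) ℝ (GroupLieAlgebra 𝓘(ℝ, E) G))
    [MeasurableSpace G] [BorelSpace G] (μ : Measure G)
    (H : Type*) [NormedAddCommGroup H] [InnerProductSpace ℝ H] [CompleteSpace H] [RKHS ℝ H G ℝ]
    (hk : ContMDiff (𝓘(ℝ, E).prod 𝓘(ℝ, E)) 𝓘(ℝ, ℝ) 2 fun z : G × G => kernelFn H z.1 z.2)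
    {Θ : Type*} [TopologicalSpace Θ] (q : G → ℝ) (p : Θ → G → ℝ)
    (w : G → ℝ) (hw : IsProbDensity μ w) (hqw : ∀ᵐ x ∂μ, w x = 0 → q x = 0)
    {Ω : Type*} [MeasurableSpace Ω] (P : Measure Ω) (X : ℕ → Ω → G)
    (hX : ∀ i, HasLaw (X i) (distr μ w) P) (hind : Pairwise fun i j => X i ⟂ᵢ[P] X j)
    (hVcont : ContinuousOn (fun z : Θ × G × G => weightedKernel H b (p z.1) q w z.2.1 z.2.2)
      {z | 0 < w z.2.1 ∧ 0 < w z.2.2})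
    (hVint : ∀ K : Set Θ, IsCompact K →
      Integrable (fun x => ⨆ θ : K, weightedKernel H b (p θ) q w x x) (distr μ w)) :
    (∀ θ, (∀ f : PiLp 2 (fun _ : Fin d => H),
        Integrable (fun x => steinOpVec b (p θ) f x * q x) μ) ∧
      BddAbove {r : ℝ | ∃ f : PiLp 2 (fun _ : Fin d => H), ‖f‖ ≤ 1 ∧
        r = ∫ x, steinOpVec b (p θ) f x * q x ∂μ}) ∧
    (∀ K : Set Θ, IsCompact K → ∀ᵐ ξ ∂P, TendstoUniformlyOn
      (fun n θ => wksdSq H b (p θ) q w n fun i => X i ξ)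
      (fun θ => ksd H b μ (p θ) q ^ 2) atTop K) ∧
    (∀ n x, Continuous fun θ => wksd H b (p θ) q w n x) ∧
    (CompactlyCoherentSpace Θ → Continuous fun θ => ksd H b μ (p θ) q) := by
  have : LocallyCompactSpace G := Manifold.locallyCompact_of_finiteDimensional 𝓘(ℝ, E)
  have := hw.isProbabilityMeasure_distr
  have := innerRegularCompactLTTop_of_locallyCompactSpace (distr μ w)
  choose Φ hΦ using fun θ => exists_isSteinFeature b (p θ) hk
  have hdom : ∀ K : Set Θ, IsCompact K → IsDominatedFeatureFamily (distr μ w) {x | 0 < w x}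
      fun θ : K => weightedFeature q w (Φ θ) := fun K hK =>
    isDominatedFeatureFamily_weightedFeature hΦ hw hVcont (hVint K hK)
  have hint : ∀ θ, Integrable (weightedFeature q w (Φ θ)) (distr μ w) := fun θ =>
    (hdom {θ} isCompact_singleton).integrable ⟨θ, rfl⟩
  have hksd := fun θ => (hΦ θ).ksd_eq_norm_integral hw hqw (hint θ)
  refine ⟨fun θ => ⟨(hΦ θ).integrable_steinOpVec_mul hw hqw (hint θ),
    ((hΦ θ).isGreatest_integral_steinOpVec_mul hw hqw (hint θ)).bddAbove⟩, fun K hK => ?_,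
    continuous_wksd hΦ hw.nonneg hVcont, fun _ => ?_⟩
  · have := isCompact_iff_compactSpace.1 hK
    simp only [tendstoUniformlyOn_iff_tendstoUniformly_comp_coe, wksdSq_eq_sampleMean,
      (hΦ _).weightedKernel_eq_inner, hksd]
    exact (hdom K hK).ae_tendstoUniformly_sampleMean_inner hX hind
  · refine CompactlyCoherentSpace.isCoherentWith.continuous_iff.2 fun K hK => ?_
    have := isCompact_iff_compactSpace.1 hK
    rw [continuousOn_iff_continuous_domRestrict]
    exact (hdom K hK).continuous_norm_integral.congr fun θ => (hksd θ).symm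

theorem theorem4p2
    -- a connected Lie group `G` with a left-invariant basis and a left Haar measure
    {E : Type*} [NormedAddCommGroup E] [NormedSpace ℝ E] [FiniteDimensional ℝ E]
    {G : Type*} [TopologicalSpace G] [T2Space G] [SecondCountableTopology G] [ConnectedSpace G]
    [ChartedSpace E G] [Group G] [LieGroup 𝓘(ℝ, E) ∞ G]
    {d : ℕ} (b : Module.Basis (Fin d) ℝ (GroupLieAlgebra 𝓘(ℝ, E) G))
    [MeasurableSpace G] [BorelSpace G] (μ : Measure G) [μ.IsHaarMeasure]
    -- a reproducing kernel Hilbert space on `G` with a `C²` kernel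
    (H : Type*) [NormedAddCommGroup H] [InnerProductSpace ℝ H] [CompleteSpace H] [RKHS ℝ H G ℝ]
    (hk : ContMDiff (𝓘(ℝ, E).prod 𝓘(ℝ, E)) 𝓘(ℝ, ℝ) 2
      (fun z : G × G => LieKSD.kernelFn H z.1 z.2))
    -- the target density, the model densities, and the sampling density
    {Θ : Type*} [MetricSpace Θ]
    (q : G → ℝ) (hq : LieKSD.IsProbDensity μ q) (hqL : LieKSD.LocLipschitz E q)
    (p : Θ → G → ℝ) (hp : ∀ θ, LieKSD.IsProbDensity μ (p θ))
    (hpL : ∀ θ, LieKSD.LocLipschitz E (p θ))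
    (w : G → ℝ) (hw : LieKSD.IsProbDensity μ w)
    (hqw : ∀ᵐ x ∂μ, w x = 0 → q x = 0)
    -- an i.i.d. sample from `w`
    {Ω : Type*} [MeasurableSpace Ω] (P : Measure Ω) [IsProbabilityMeasure P]
    (X : ℕ → Ω → G) (hX : ∀ i, HasLaw (X i) (LieKSD.distr μ w) P) (hind : iIndepFun X P)
    -- joint continuity of `V` and integrability of the suprema of `V` over compact sets
    (hVcont : ContinuousOn
      (fun z : Θ × G × G => LieKSD.weightedKernel H b (p z.1) q w z.2.1 z.2.2)
      {z | 0 < w z.2.1 ∧ 0 < w z.2.2})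
    (hVint : ∀ K : Set Θ, IsCompact K → Integrable
      (fun x => ⨆ θ : K, LieKSD.weightedKernel H b (p θ) q w x x) (LieKSD.distr μ w)) :
    -- `KSD` is a supremum of a bounded set of honest expectations
    (∀ θ, (∀ f : PiLp 2 (fun _ : Fin d => H),
        Integrable (fun x => LieKSD.steinOpVec b (p θ) f x * q x) μ) ∧
      BddAbove {r : ℝ | ∃ f : PiLp 2 (fun _ : Fin d => H), ‖f‖ ≤ 1 ∧
        r = ∫ x, LieKSD.steinOpVec b (p θ) f x * q x ∂μ}) ∧
    -- locally uniform convergence, almost surely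
    (∀ K : Set Θ, IsCompact K → ∀ᵐ ξ ∂P, TendstoUniformlyOn
      (fun (n : ℕ) (θ : Θ) => LieKSD.wksdSq H b (p θ) q w n (fun i => X i ξ))
      (fun θ => LieKSD.ksd H b μ (p θ) q ^ 2) atTop K) ∧
    -- continuity
    (LocallyCompactSpace Θ →
      (∀ (n : ℕ) (ξ : Ω), Continuous
        (fun θ => LieKSD.wksd H b (p θ) q w n (fun i => X i ξ))) ∧
      Continuous (fun θ => LieKSD.ksd H b μ (p θ) q)) := by
  obtain ⟨hint, hconv, hwksd, hksd⟩ := theorem4p2_general b μ H hk q p w hw hqw P X hX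
    (fun i j hij => hind.indepFun hij) hVcont hVint
  exact ⟨hint, hconv, fun _ => ⟨fun n ξ => hwksd n _, hksd inferInstance⟩⟩
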